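/- Let $\mathcal H_A,\mathcal H_B$ be Hilbert spaces of finite dimensions $d_A,d_B$ and let $\rho_{AB}$ be a quantum state (positive, trace one) on $\mathcal H_A\otimes\mathcal H_B$. Write $S(\sigma)=-\mathrm{Tr}\,\sigma\log_2\sigma$ and $S(A|B)_\rho=S(\rho_{AB})-S(\rho_B)$ with $\rho_B=\mathrm{Tr}_A\rho_{AB}$. For a state $\rho_{AK}$ on $\mathcal H_A\otimes\mathcal H_K$ and a real number $\epsilon$, let $$R_\epsilon(A|K)_\rho=\sup\Big\{\lambda\in\mathbb R\ \Big|\ \mathrm{Tr}\big[\{\mathrm{Tr}_A[\rho_{AK}^2]-2^{-\lambda}\rho_K^2\le 0\}\,\rho_K\big]\ge 1-\epsilon\Big\}\in[-\infty,\infty],$$ where $\{X\le0\}$ is the spectral projection of the self-adjoint operator $X$ onto its eigenvalues $\le 0$, and let $$\overline R_\epsilon(A|B)_\rho=\sup_{\mathcal H_C,\ \rho_{ABC}:\ \mathrm{Tr}_C\rho_{ABC}=\rho_{AB}}R_\epsilon(A|BC)_\rho ,$$ the supremum being over all Hilbert spaces $\mathcal H_C$ and all states $\rho_{ABC}$ on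 $\mathcal H_A\otimes\mathcal H_B\otimes\mathcal H_C$ with marginal $\rho_{AB}$. Let $\overline R_\epsilon(A^n|B^n)_{\rho^{\otimes n}}$ be this quantity for the state $\rho_{AB}^{\otimes n}$ on $\mathcal H_A^{\otimes n}\otimes\mathcal H_B^{\otimes n}$. (1) For every sequence $\epsilon_n>0$ with $\epsilon_n\to0$ and $\frac1n\log_2\epsilon_n\to0$ as $n\to\infty$ (that is, $\epsilon_n$ converges to $0$ slower than exponentially), $$\liminf_{n\to\infty}\frac1n\,\overline R_{\epsilon_n}(A^n|B^n)_{\rho^{\otimes n}}\ \ge\ S(A|B)_\rho .$$ (2) In particular, for every $\nu\in(0,1)$ the sequence $\epsilon_n=\epsilon_{1,n}^{1/2}+\epsilon_{1,n}+\epsilon_{2,n}$ with $\epsilon_{1,n}=(1+n)^{d_Ad_B}2^{-n^{\nu}}$ and $\epsilon_{2,n}=(1+n)^{d_B}2^{-n^{\nu}}$ converges to $0$, and the same inequality holds for it. -/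

import Mathlib

open Filter Topology
open scoped ComplexOrder

noncomputable section

namespace QEntropy

/-- The von Neumann entropy `S(ρ) = - Tr ρ log₂ ρ` of a Hermitian matrix (with `0 log₂ 0 = 0`). -/
def vonNeumann {ι : Type*} [Fintype ι] [DecidableEq ι] (ρ : Matrix ι ι ℂ) : ℝ :=
  -(Matrix.trace (cfc (fun x : ℝ => x * Real.logb 2 x) ρ)).re

/-- The marginal `ρ_B = Tr_A ρ_AB` of a bipartite matrix. -/
def marginalB {a b : Type*} [Fintype a] (ρ : Matrix (a × b) (a × b) ℂ) : Matrix b b ℂ :=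
  Matrix.of fun y y' => ∑ x, ρ (x, y) (x, y')

/-- The conditional von Neumann entropy `S(A|B)_ρ = S(ρ_AB) - S(ρ_B)`. -/
def condEntropy {a b : Type*} [Fintype a] [Fintype b] [DecidableEq a] [DecidableEq b]
    (ρ : Matrix (a × b) (a × b) ℂ) : ℝ :=
  vonNeumann ρ - vonNeumann (marginalB ρ)

/-- The state `ρ_AB^{⊗ n}`, on the bipartite system formed by `Aⁿ` and `Bⁿ`. -/
def tensorPower {a b : Type*} (ρ : Matrix (a × b) (a × b) ℂ) (n : ℕ) :
    Matrix ((Fin n → a) × (Fin n → b)) ((Fin n → a) × (Fin n → b)) ℂ :=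
  Matrix.of fun p q => ∏ i, ρ (p.1 i, p.2 i) (q.1 i, q.2 i)

/-- `T` is a trace-class operator with trace `t`: the diagonal sum converges (unconditionally, hence
absolutely) to `t` in every Hilbert basis. -/
def HasTrace {K : Type*} [NormedAddCommGroup K] [InnerProductSpace ℂ K]
    (T : K →L[ℂ] K) (t : ℂ) : Prop :=
  ∀ (w : Set K) (e : HilbertBasis w ℂ K), HasSum (fun i => inner ℂ (e i) (T (e i))) t

/-- The spectral projection `{X ≤ 0}` of a compact self-adjoint operator `X`: the orthogonal
projection onto the closed span of all eigenvectors of `X` with eigenvalue `≤ 0`. -/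
def projNonpos {K : Type*} [NormedAddCommGroup K] [InnerProductSpace ℂ K] [CompleteSpace K]
    (X : K →L[ℂ] K) : K →L[ℂ] K :=
  (⨆ μ ∈ Set.Iic (0 : ℝ),
    Module.End.eigenspace (X : K →ₗ[ℂ] K) (μ : ℂ)).topologicalClosure.starProjection

/-! An operator on `ℂ^a ⊗ K`, for a finite index set `a` and a Hilbert space `K`, is written as the
matrix `M : Matrix a a (K →L[ℂ] K)` of its blocks `⟨x| M |x'⟩`. Composition of operators is the
product of matrices, and the partial trace over `ℂ^a` is `Matrix.trace`. -/

/-- Positivity of the operator on `ℂ^a ⊗ K` with blocks `M`. -/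
def BlockPositive {a K : Type*} [Fintype a] [NormedAddCommGroup K] [InnerProductSpace ℂ K]
    (M : Matrix a a (K →L[ℂ] K)) : Prop :=
  ∀ v : a → K, 0 ≤ ∑ x, ∑ x', inner ℂ (v x) (M x x' (v x'))

/-- The information spectrum collision entropy `R_ε(A|K)_ρ` of a state `ρ_AK` on `ℂ^a ⊗ K` given by
its blocks `M`, the supremum of all real `l` with
`Tr [{Tr_A[ρ_AK²] - 2^{-l} ρ_K² ≤ 0} ρ_K] ≥ 1 - ε`. It is an extended real number. -/
def collisionEntropy {a K : Type*} [Fintype a] [NormedAddCommGroup K] [InnerProductSpace ℂ K]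
    [CompleteSpace K] (M : Matrix a a (K →L[ℂ] K)) (ε : ℝ) : EReal :=
  ⨆ l ∈ {l : ℝ | ∃ t : ℂ,
      HasTrace (projNonpos ((M * M).trace - (((2 : ℝ) ^ (-l) : ℝ) : ℂ) • (M.trace * M.trace))
        * M.trace) t ∧ 1 - ε ≤ t.re}, (l : EReal)

/-- The Hilbert space `ℂ^b ⊗ C`. -/
abbrev Tens (b C : Type*) : Type _ := PiLp 2 (fun _ : b => C)

/-- The block `⟨y| T |y'⟩` of an operator `T` on `ℂ^b ⊗ C`. -/
def block {b C : Type*} [Fintype b] [DecidableEq b] [NormedAddCommGroup C] [InnerProductSpace ℂ C]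
    (T : Tens b C →L[ℂ] Tens b C) (y y' : b) : C →L[ℂ] C :=
  (PiLp.proj (𝕜 := ℂ) 2 (fun _ : b => C) y) ∘L T ∘L
    ((PiLp.continuousLinearEquiv 2 ℂ (fun _ : b => C)).symm : (b → C) →L[ℂ] Tens b C) ∘L
    ContinuousLinearMap.single ℂ (fun _ : b => C) y'

/-- `M` is a state `ρ_ABC` on `ℂ^a ⊗ (ℂ^b ⊗ C)` with `Tr_C ρ_ABC = ρ_AB`. (It has trace one as soon
as `ρ_AB` has.) -/
def IsExtension {a b C : Type*} [Fintype a] [Fintype b] [DecidableEq b]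
    [NormedAddCommGroup C] [InnerProductSpace ℂ C]
    (ρ : Matrix (a × b) (a × b) ℂ) (M : Matrix a a (Tens b C →L[ℂ] Tens b C)) : Prop :=
  BlockPositive M ∧ ∀ x x' y y', HasTrace (block (M x x') y y') (ρ (x, y) (x', y'))

/-- The information spectrum collision entropy with optimal side information: the supremum of
`R_ε(A|BC)` over all Hilbert spaces `C` and all extensions `ρ_ABC` of `ρ_AB`. Spaces `C` in `Type`
suffice, because a trace-class operator lives on a separable subspace. -/
def optCollisionEntropy {a b : Type*} [Fintype a] [Fintype b] [DecidableEq b]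
    (ρ : Matrix (a × b) (a × b) ℂ) (ε : ℝ) : EReal :=
  sSup {r : EReal | ∃ (C : Type) (_ : NormedAddCommGroup C) (_ : InnerProductSpace ℂ C)
    (_ : CompleteSpace C) (M : Matrix a a (Tens b C →L[ℂ] Tens b C)),
      IsExtension ρ M ∧ r = collisionEntropy M ε}

/-- The smoothing parameters `ε = ε₁^{1/2} + ε₁ + ε₂` with `ε₁ = (1 + n)^{d_A d_B} 2^{-n^ν}` and
`ε₂ = (1 + n)^{d_B} 2^{-n^ν}`. -/
def smoothing (dA dB : ℕ) (ν : ℝ) (n : ℕ) : ℝ :=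
  Real.sqrt ((1 + n : ℝ) ^ (dA * dB) * (2 : ℝ) ^ (-(n : ℝ) ^ ν))
    + (1 + n : ℝ) ^ (dA * dB) * (2 : ℝ) ^ (-(n : ℝ) ^ ν)
    + (1 + n : ℝ) ^ dB * (2 : ℝ) ^ (-(n : ℝ) ^ ν)

end QEntropy

end

set_option linter.unusedSectionVars false

namespace QEntropy

open Matrix

/-! A lower bound on the supremum needs only one good extension. The eigenvalue of `ρ^{⊗n}` at a
sequence of eigenvectors of `ρ` depends only on the type of the sequence, so grouping by type gives
`ρ^{⊗n} = ∑ₜ σₜ` with `σₜ² = pₜ σₜ` and at most `(n+1)^(d_A d_B)` terms. The extension `∑ₜ σₜ ⊗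
|t⟩⟨t|` records the type in a classical register. With `Nₜ = Tr_A σₜ`, the operator defining the
collision entropy becomes the direct sum of the `pₜ Nₜ - 2^{-l} Nₜ²`, so an eigenvector of `Nₜ` with
eigenvalue `μ` can be lost only if `0 < μ < 2^l pₜ` (`le_optCollisionEntropy`).

The lost weight has three parts (`sum_bad_eigenvalues_le`). Blocks with `pₜ > P = 2^{-n(S(AB)-δ)}`
are atypical and are given up entirely. In any other block the lost eigenvalues are at most `2^l P`;
comparison with the eigenbasis of `ρ_B^{⊗n}` bounds their weight by `2^l P |G|` plus the weight of
`Nₜ` outside `G`, where `G` collects the eigenvectors of eigenvalue at least `2^{-n(S(B)+δ)}`, so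
that `|G| ≤ 2^{n(S(B)+δ)}`. Summed over `t`, the weights outside `G` give that of `ρ_B^{⊗n}`.
Chernoff's bound (`exists_tail_bound`) controls both atypical weights. At `l = n(S(A|B) - 3δ)` the
total is a polynomial times an exponentially small term, hence eventually below every subexponential
`εₙ`. -/

theorem hasTrace_of_finiteDimensional {K : Type*} [NormedAddCommGroup K] [InnerProductSpace ℂ K]
    [FiniteDimensional ℂ K] (T : K →L[ℂ] K) : HasTrace T (LinearMap.trace ℂ K T) := by
  intro w e
  have : Finite w := e.orthonormal.linearIndependent.finite
  cases nonempty_fintype w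
  rw [LinearMap.trace_eq_sum_inner _ e.toOrthonormalBasis]
  simpa using hasSum_fintype (fun i => inner ℂ (e i) (T (e i)))

/-- Operators on `ℂ^B ⊗ C`. -/
abbrev TensOp (B C : Type*) [NormedAddCommGroup C] [InnerProductSpace ℂ C] : Type _ :=
  Tens B C →L[ℂ] Tens B C

/-! ### Operators that are block diagonal in a classical register -/

section DirectSum

variable {B : Type*} [Fintype B] {T : Type} [Fintype T]

/-- The operator `⨁ₜ S t` on `ℂ^B ⊗ ℂ^T ≅ ⨁ₜ ℂ^B`. -/
noncomputable def directSum (S : T → Matrix B B ℂ) :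
    TensOp B (EuclideanSpace ℂ T) where
  toFun v := WithLp.toLp 2 fun y => WithLp.toLp 2 fun t => ∑ y', S t y y' * v y' t
  map_add' := by
    intro v w
    ext y t
    simp [mul_add, Finset.sum_add_distrib]
  map_smul' := by
    intro c v
    ext y t
    simp [Finset.mul_sum, mul_left_comm]
  cont := by fun_prop

theorem directSum_apply (S : T → Matrix B B ℂ) (v : Tens B (EuclideanSpace ℂ T)) (y : B) (t : T) :
    directSum S v y t = ∑ y', S t y y' * v y' t := rfl

theorem directSum_mul (S S' : T → Matrix B B ℂ) :
    directSum S * directSum S' = directSum (fun t => S t * S' t) := by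
  ext v y t
  simp only [mul_apply_eq_comp, directSum_apply, Matrix.mul_apply, Finset.mul_sum,
    Finset.sum_mul]
  rw [Finset.sum_comm]
  simp only [mul_assoc]

theorem directSum_sum {α : Type*} (s : Finset α) (S : α → T → Matrix B B ℂ) :
    ∑ i ∈ s, directSum (S i) = directSum (fun t => ∑ i ∈ s, S i t) := by
  ext v y t
  simp only [_root_.sum_apply, directSum_apply, WithLp.ofLp_sum, Finset.sum_apply,
    Matrix.sum_apply, Finset.sum_mul]
  rw [Finset.sum_comm]

/-- The vector `v ⊗ |t⟩`. -/
noncomputable def flagged [DecidableEq T] (v : B → ℂ) (t : T) : Tens B (EuclideanSpace ℂ T) :=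
  WithLp.toLp 2 fun y => EuclideanSpace.single t (v y)

theorem directSum_flagged [DecidableEq T] (S : T → Matrix B B ℂ) (v : B → ℂ) (t : T) :
    directSum S (flagged v t) = flagged (S t *ᵥ v) t := by
  ext y t'
  rw [directSum_apply]
  by_cases h : t' = t
  · subst h
    simp [flagged, Matrix.mulVec, dotProduct]
  · simp [flagged, h]

theorem flagged_smul [DecidableEq T] (c : ℂ) (v : B → ℂ) (t : T) :
    flagged (c • v) t = c • flagged v t := by
  ext y t'
  by_cases h : t' = t <;> simp [flagged, h]

theorem inner_flagged [DecidableEq T] (v w : B → ℂ) (t t' : T) :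
    inner ℂ (flagged v t) (flagged w t') = if t = t' then ∑ y, star (v y) * w y else 0 := by
  rw [PiLp.inner_apply]
  by_cases h : t = t'
  · subst h
    simp [flagged, EuclideanSpace.inner_single_left, mul_comm]
  · simp [flagged, EuclideanSpace.inner_single_left, h]

/-- This dimension count turns the orthonormal family of flagged eigenvectors into a basis. -/
theorem finrank_tens : Module.finrank ℂ (Tens B (EuclideanSpace ℂ T)) =
    Fintype.card (T × B) := by
  rw [(WithLp.linearEquiv 2 ℂ (B → EuclideanSpace ℂ T)).finrank_eq, Module.finrank_pi_fintype]
  simp [mul_comm]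

theorem hasTrace_block_directSum [DecidableEq B] (S : T → Matrix B B ℂ) (y y' : B) :
    HasTrace (block (directSum S) y y') (∑ t, S t y y') := by
  classical
  suffices h : ∑ t, S t y y' = LinearMap.trace ℂ _ (block (directSum S) y y') by
    rw [h]
    exact hasTrace_of_finiteDimensional (K := EuclideanSpace ℂ T) _
  rw [LinearMap.trace_eq_sum_inner _ (EuclideanSpace.basisFun T ℂ)]
  refine Finset.sum_congr rfl fun t _ => ?_
  rw [EuclideanSpace.basisFun_apply, EuclideanSpace.inner_single_left]
  change _ = _ * (directSum S (WithLp.toLp 2 (Pi.single y' (EuclideanSpace.single t 1)))) y t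
  rw [directSum_apply, Finset.sum_eq_single y']
  · simp
  · intro z _ hz
    simp [Pi.single_eq_of_ne hz]
  · simp

end DirectSum

/-! ### The flagged extension and its collision entropy -/

section Extension

variable {A B : Type*} [Fintype A] [Fintype B] [DecidableEq B] {T : Type} [Fintype T]

/-- The blocks of the state `∑ₜ σ t ⊗ |t⟩⟨t|`. -/
noncomputable def flaggedState (σ : T → Matrix (A × B) (A × B) ℂ) :
    Matrix A A (TensOp B (EuclideanSpace ℂ T)) :=
  Matrix.of fun x x' => directSum fun t => Matrix.of fun y y' => σ t (x, y) (x', y')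

theorem isExtension_flaggedState {σ : T → Matrix (A × B) (A × B) ℂ} (hσ : ∀ t, (σ t).PosSemidef) :
    IsExtension (∑ t, σ t) (flaggedState σ) := by
  refine ⟨fun v => ?_, fun x x' y y' => ?_⟩
  · have key : ∑ x, ∑ x', inner ℂ (v x) (flaggedState σ x x' (v x')) =
        ∑ t, star (fun p : A × B => v p.1 p.2 t) ⬝ᵥ (σ t *ᵥ fun p : A × B => v p.1 p.2 t) := by
      have hl : ∀ x x', inner ℂ (v x) (flaggedState σ x x' (v x')) =
          ∑ t, ∑ y, ∑ y', star (v x y t) * (σ t (x, y) (x', y') * v x' y' t) := fun x x' => by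
        simp only [PiLp.inner_apply, flaggedState, Matrix.of_apply, directSum_apply,
          RCLike.inner_apply, Finset.sum_mul]
        rw [Finset.sum_comm]
        refine Finset.sum_congr rfl fun t _ => Finset.sum_congr rfl fun y _ =>
          Finset.sum_congr rfl fun y' _ => mul_comm _ _
      have hr : ∀ t, star (fun p : A × B => v p.1 p.2 t) ⬝ᵥ
          (σ t *ᵥ fun p : A × B => v p.1 p.2 t) =
          ∑ x, ∑ x', ∑ y, ∑ y', star (v x y t) * (σ t (x, y) (x', y') * v x' y' t) := fun t => by
        simp only [dotProduct, Matrix.mulVec, Fintype.sum_prod_type, Pi.star_apply, Finset.mul_sum]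
        exact Finset.sum_congr rfl fun x _ => Finset.sum_comm
      simp only [hl, hr]
      rw [Finset.sum_comm (s := (Finset.univ : Finset T))]
      refine Finset.sum_congr rfl fun x _ => ?_
      rw [Finset.sum_comm]
    rw [key]
    exact Finset.sum_nonneg fun t _ => (hσ t).dotProduct_mulVec_nonneg _
  · rw [Matrix.sum_apply]
    exact hasTrace_block_directSum _ y y'

theorem trace_flaggedState (σ : T → Matrix (A × B) (A × B) ℂ) :
    (flaggedState σ).trace = directSum fun t => marginalB (σ t) := by
  simp only [Matrix.trace, Matrix.diag, flaggedState, Matrix.of_apply, directSum_sum]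
  congr 1
  ext t y y'
  simp [marginalB, Matrix.sum_apply]

/-- Distinct flags are orthogonal, so squaring produces no cross terms between the summands. -/
theorem trace_flaggedState_mul_self (σ : T → Matrix (A × B) (A × B) ℂ) :
    (flaggedState σ * flaggedState σ).trace = directSum fun t => marginalB (σ t * σ t) := by
  simp only [Matrix.trace, Matrix.diag, flaggedState, Matrix.mul_apply, Matrix.of_apply,
    directSum_mul, directSum_sum]
  congr 1
  ext t y y'
  simp [marginalB, Matrix.sum_apply, Matrix.mul_apply, Fintype.sum_prod_type]

theorem marginalB_smul (c : ℂ) (σ : Matrix (A × B) (A × B) ℂ) :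
    marginalB (c • σ) = c • marginalB σ := by
  ext y y'
  simp [marginalB, Finset.mul_sum]

theorem marginalB_sum (σ : T → Matrix (A × B) (A × B) ℂ) :
    marginalB (∑ t, σ t) = ∑ t, marginalB (σ t) := by
  ext y y'
  simp only [marginalB, Matrix.of_apply, Matrix.sum_apply]
  exact Finset.sum_comm

theorem trace_marginalB (σ : Matrix (A × B) (A × B) ℂ) : (marginalB σ).trace = σ.trace := by
  simp only [marginalB, Matrix.trace, Matrix.diag, Matrix.of_apply, Fintype.sum_prod_type]
  exact Finset.sum_comm

theorem posSemidef_marginalB {σ : Matrix (A × B) (A × B) ℂ} (hσ : σ.PosSemidef) :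
    (marginalB σ).PosSemidef := by
  have : marginalB σ = ∑ x, σ.submatrix (fun y => (x, y)) (fun y => (x, y)) := by
    ext y y'
    simp [marginalB, Matrix.sum_apply]
  rw [this]
  exact Matrix.posSemidef_sum _ fun x _ => hσ.submatrix _

/-- If the spectral decomposition of `Tr_A σₜ` gives the complementary spectral projection of
`∑ₜ σₜ ⊗ |t⟩⟨t|` a weight at most `ε`, then `l` is a lower bound of the optimized collision
entropy. -/
theorem le_optCollisionEntropy [DecidableEq T] {ρ : Matrix (A × B) (A × B) ℂ} (htr : ρ.trace = 1)
    {σ : T → Matrix (A × B) (A × B) ℂ} (hσ : ∀ t, (σ t).PosSemidef) (hsum : ∑ t, σ t = ρ)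
    {p : T → ℝ} (hp : ∀ t, σ t * σ t = (p t : ℂ) • σ t) {l ε : ℝ}
    (hbad : ∑ t, ∑ j, (if p t * (posSemidef_marginalB (hσ t)).1.eigenvalues j -
        (2 : ℝ) ^ (-l) * (posSemidef_marginalB (hσ t)).1.eigenvalues j ^ 2 ≤ 0 then 0
        else (posSemidef_marginalB (hσ t)).1.eigenvalues j) ≤ ε) :
    (l : EReal) ≤ optCollisionEntropy ρ ε := by
  refine le_trans ?_ (le_sSup ⟨EuclideanSpace ℂ T, inferInstance, inferInstance, inferInstance,
    flaggedState σ, hsum ▸ isExtension_flaggedState hσ, rfl⟩)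
  refine le_iSup₂_of_le l ⟨_, hasTrace_of_finiteDimensional _, ?_⟩ le_rfl
  set μ : T → B → ℝ := fun t j => (posSemidef_marginalB (hσ t)).1.eigenvalues j with hμ
  have hμ0 : ∀ t j, 0 ≤ μ t j := fun t j => (posSemidef_marginalB (hσ t)).eigenvalues_nonneg j
  set V : T → B → B → ℂ :=
    fun t j => ((posSemidef_marginalB (hσ t)).1.eigenvectorBasis j).ofLp with hV
  have hVμ : ∀ t j, marginalB (σ t) *ᵥ V t j = (μ t j : ℂ) • V t j := fun t j =>
    (posSemidef_marginalB (hσ t)).1.mulVec_eigenvectorBasis j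
  -- Flagged eigenvectors of the blocks `Tr_A σₜ` diagonalize both operators in the definition; the
  -- trace is computed in this basis.
  have hon : Orthonormal ℂ (fun q : T × B => flagged (V q.1 q.2) q.1) := by
    rw [orthonormal_iff_ite]
    rintro ⟨t, j⟩ ⟨t', j'⟩
    rw [inner_flagged]
    by_cases h : t = t'
    · subst h
      have := orthonormal_iff_ite.1
        (posSemidef_marginalB (hσ t)).1.eigenvectorBasis.orthonormal j j'
      rw [PiLp.inner_apply] at this
      simp only [RCLike.inner_apply] at this
      simp only [Prod.mk.injEq, true_and, if_true]
      rw [← this]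
      exact Finset.sum_congr rfl fun y _ => mul_comm _ _
    · simp [h]
  have hspan : Submodule.span ℂ (Set.range fun q : T × B => flagged (V q.1 q.2) q.1) = ⊤ :=
    hon.linearIndependent.span_eq_top_of_card_eq_finrank' finrank_tens.symm
  set e := OrthonormalBasis.mk hon hspan.ge with he
  rw [LinearMap.trace_eq_sum_inner _ e]
  set G := (flaggedState σ).trace with hG
  set X := (flaggedState σ * flaggedState σ).trace - (((2 : ℝ) ^ (-l) : ℝ) : ℂ) • (G * G) with hX
  have heq : ∀ t j, e (t, j) = flagged (V t j) t := fun t j => by simp [he]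
  have hGe : ∀ t j, G (e (t, j)) = (μ t j : ℂ) • e (t, j) := fun t j => by
    rw [heq, hG, trace_flaggedState, directSum_flagged, hVμ, flagged_smul]
  have hXe : ∀ t j, X (e (t, j)) =
      ((p t * μ t j - (2 : ℝ) ^ (-l) * μ t j ^ 2 : ℝ) : ℂ) • e (t, j) := fun t j => by
    have h1 : (flaggedState σ * flaggedState σ).trace (e (t, j)) =
        ((p t : ℂ) * μ t j) • e (t, j) := by
      rw [heq, trace_flaggedState_mul_self, directSum_flagged, hp, marginalB_smul,
        Matrix.smul_mulVec, hVμ, smul_smul, flagged_smul]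
    rw [hX, _root_.sub_apply, h1, _root_.smul_apply,
      mul_apply_eq_comp, hGe, map_smul, hGe, smul_smul, smul_smul, ← sub_smul]
    congr 1
    push_cast
    ring
  -- A good eigenvector is fixed by the projection and contributes all of `μ`. For a bad one,
  -- positivity of the projection is enough: its exact image is not needed.
  have hterm : ∀ t j, μ t j - (if p t * μ t j - (2 : ℝ) ^ (-l) * μ t j ^ 2 ≤ 0 then 0
      else μ t j) ≤ (inner ℂ (e (t, j)) ((projNonpos X * G) (e (t, j)))).re := by
    intro t j
    rw [mul_apply_eq_comp, hGe, map_smul, inner_smul_right, Complex.re_ofReal_mul]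
    split_ifs with h
    · have hmem : e (t, j) ∈ (⨆ ν ∈ Set.Iic (0 : ℝ), Module.End.eigenspace
          (X : Tens B (EuclideanSpace ℂ T) →ₗ[ℂ] Tens B (EuclideanSpace ℂ T))
          (ν : ℂ)).topologicalClosure := by
        apply Submodule.le_topologicalClosure
        refine Submodule.mem_iSup_of_mem _ (Submodule.mem_iSup_of_mem h ?_)
        rw [Module.End.mem_eigenspace_iff]
        exact hXe t j
      rw [projNonpos, Submodule.starProjection_eq_self_iff.2 hmem,
        orthonormal_iff_ite.1 e.orthonormal]
      simp
    · rw [sub_self]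
      refine mul_nonneg (hμ0 t j) ?_
      have := Submodule.re_inner_starProjection_nonneg ((⨆ ν ∈ Set.Iic (0 : ℝ),
        Module.End.eigenspace (X : Tens B (EuclideanSpace ℂ T) →ₗ[ℂ] Tens B (EuclideanSpace ℂ T))
          (ν : ℂ)).topologicalClosure) (e (t, j))
      rw [← inner_re_symm] at this
      exact this
  have htot : ∑ t, ∑ j, μ t j = 1 := by
    have : ∀ t, ((∑ j, μ t j : ℝ) : ℂ) = (σ t).trace := fun t => by
      rw [← trace_marginalB, (posSemidef_marginalB (hσ t)).1.trace_eq_sum_eigenvalues]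
      simp [hμ]
    have h2 : ((∑ t, ∑ j, μ t j : ℝ) : ℂ) = 1 := by
      rw [Complex.ofReal_sum, Finset.sum_congr rfl fun t _ => this t, ← Matrix.trace_sum, hsum, htr]
    exact_mod_cast h2
  calc 1 - ε ≤ ∑ t, ∑ j, (μ t j - (if p t * μ t j - (2 : ℝ) ^ (-l) * μ t j ^ 2 ≤ 0 then 0
      else μ t j)) := by
        simp only [Finset.sum_sub_distrib, htot]
        linarith
    _ ≤ ∑ t, ∑ j, (inner ℂ (e (t, j)) ((projNonpos X * G) (e (t, j)))).re :=
        Finset.sum_le_sum fun t _ => Finset.sum_le_sum fun j _ => hterm t j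
    _ = _ := by
        rw [Complex.re_sum, Fintype.sum_prod_type]
        rfl

end Extension

/-! ### Weight carried by small eigenvalues -/

theorem sum_normSq_row {B : Type*} [Fintype B] [DecidableEq B] {W : Matrix B B ℂ}
    (hW : W ∈ unitaryGroup B ℂ) (k : B) : ∑ j, Complex.normSq (W k j) = 1 := by
  have h := congrFun (congrFun (mem_unitaryGroup_iff.1 hW) k) k
  rw [Matrix.mul_apply, Matrix.one_apply_eq] at h
  have h' : ((∑ j, Complex.normSq (W k j) : ℝ) : ℂ) = 1 := by
    rw [← h]
    push_cast
    exact Finset.sum_congr rfl fun j _ => by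
      rw [Matrix.star_apply, Complex.star_def, Complex.mul_conj]
  exact_mod_cast h'

theorem sum_normSq_col {B : Type*} [Fintype B] [DecidableEq B] {W : Matrix B B ℂ}
    (hW : W ∈ unitaryGroup B ℂ) (j : B) : ∑ k, Complex.normSq (W k j) = 1 := by
  have h := congrFun (congrFun (mem_unitaryGroup_iff'.1 hW) j) j
  rw [Matrix.mul_apply, Matrix.one_apply_eq] at h
  have h' : ((∑ k, Complex.normSq (W k j) : ℝ) : ℂ) = 1 := by
    rw [← h]
    push_cast
    exact Finset.sum_congr rfl fun k _ => by
      rw [Matrix.star_apply, Complex.star_def, mul_comm, Complex.mul_conj]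
  exact_mod_cast h'

/-- The weight of the small eigenvalues of a positive matrix `N`, estimated through the diagonal of
`N` in any orthonormal basis. -/
theorem sum_small_eigenvalues_le {B : Type*} [Fintype B] [DecidableEq B] {N : Matrix B B ℂ}
    (hN : N.PosSemidef) {F : Matrix B B ℂ} (hF : F ∈ unitaryGroup B ℂ) {τ : ℝ} (hτ : 0 ≤ τ)
    (S G : Finset B) (hS : ∀ j ∈ S, hN.1.eigenvalues j ≤ τ) :
    ∑ j ∈ S, hN.1.eigenvalues j ≤ τ * G.card + ∑ k ∈ Gᶜ, ((star F * N * F) k k).re := by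
  set V : Matrix B B ℂ := (hN.1.eigenvectorUnitary : Matrix B B ℂ) with hV
  -- `W` holds the overlaps of the two bases; its squared moduli form a doubly stochastic matrix,
  -- which carries the eigenvalues of `N` to its diagonal in the basis `F`.
  set W : Matrix B B ℂ := star F * V with hWdef
  have hW : W ∈ unitaryGroup B ℂ := mul_mem (Unitary.star_mem hF) hN.1.eigenvectorUnitary.2
  set w : B → B → ℝ := fun k j => Complex.normSq (W k j) with hw
  have hw0 : ∀ k j, 0 ≤ w k j := fun k j => Complex.normSq_nonneg _
  have hμ0 : ∀ j, 0 ≤ hN.1.eigenvalues j := fun j => hN.eigenvalues_nonneg j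
  have hdiag : ∀ k, ((star F * N * F) k k).re = ∑ j, hN.1.eigenvalues j * w k j := fun k => by
    have h1 : star F * N * F = W * diagonal (RCLike.ofReal ∘ hN.1.eigenvalues) * star W := by
      conv_lhs => rw [hN.1.spectral_theorem]
      rw [Unitary.conjStarAlgAut_apply, hWdef, star_mul, star_star]
      simp only [Matrix.mul_assoc]
      rfl
    have h2 : (star F * N * F) k k = ((∑ j, hN.1.eigenvalues j * w k j : ℝ) : ℂ) := by
      rw [h1, Matrix.mul_apply]
      push_cast
      refine Finset.sum_congr rfl fun j _ => ?_
      rw [Matrix.mul_diagonal, Matrix.star_apply]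
      change W k j * (hN.1.eigenvalues j : ℂ) * (starRingEnd ℂ) (W k j) = _
      rw [mul_right_comm, Complex.mul_conj, mul_comm]
    rw [h2, Complex.ofReal_re]
  calc ∑ j ∈ S, hN.1.eigenvalues j = ∑ j ∈ S, ∑ k, hN.1.eigenvalues j * w k j :=
        Finset.sum_congr rfl fun j _ => by rw [← Finset.mul_sum, sum_normSq_col hW, mul_one]
    _ = ∑ k, ∑ j ∈ S, hN.1.eigenvalues j * w k j := Finset.sum_comm
    _ = ∑ k ∈ G, ∑ j ∈ S, hN.1.eigenvalues j * w k j +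
          ∑ k ∈ Gᶜ, ∑ j ∈ S, hN.1.eigenvalues j * w k j := (Finset.sum_add_sum_compl G _).symm
    _ ≤ ∑ k ∈ G, τ + ∑ k ∈ Gᶜ, ((star F * N * F) k k).re := by
        refine add_le_add (Finset.sum_le_sum fun k _ => ?_) (Finset.sum_le_sum fun k _ => ?_)
        · calc ∑ j ∈ S, hN.1.eigenvalues j * w k j ≤ ∑ j ∈ S, τ * w k j :=
                Finset.sum_le_sum fun j hj => mul_le_mul_of_nonneg_right (hS j hj) (hw0 k j)
            _ ≤ ∑ j, τ * w k j := Finset.sum_le_univ_sum_of_nonneg fun j => mul_nonneg hτ (hw0 k j)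
            _ = τ := by rw [← Finset.mul_sum, sum_normSq_row hW, mul_one]
        · rw [hdiag]
          exact Finset.sum_le_univ_sum_of_nonneg fun j => mul_nonneg (hμ0 j) (hw0 k j)
    _ = τ * G.card + ∑ k ∈ Gᶜ, ((star F * N * F) k k).re := by
        rw [Finset.sum_const, nsmul_eq_mul, mul_comm]

/-- A block with `p t > P` is charged its full trace. Every other block pays for `G` separately,
whence the factor `Fintype.card T`, while the diagonals outside `G` add up to that of `∑ t, N t`,
since all blocks are compared with the same basis `F`. -/
theorem sum_bad_eigenvalues_le {T B : Type*} [Fintype T] [Fintype B] [DecidableEq B]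
    {N : T → Matrix B B ℂ} (hN : ∀ t, (N t).PosSemidef) {F : Matrix B B ℂ}
    (hF : F ∈ unitaryGroup B ℂ) (p : T → ℝ) (l P : ℝ) (hP : 0 ≤ P) (G : Finset B) :
    ∑ t, ∑ j, (if p t * (hN t).1.eigenvalues j - (2 : ℝ) ^ (-l) * (hN t).1.eigenvalues j ^ 2 ≤ 0
      then 0 else (hN t).1.eigenvalues j) ≤
    ∑ t, (if P < p t then (N t).trace.re else 0) + Fintype.card T * (2 ^ l * P * G.card) +
      ∑ k ∈ Gᶜ, ((star F * (∑ t, N t) * F) k k).re := by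
  have h2 : (0 : ℝ) < 2 ^ l := by positivity
  have hdiag0 : ∀ t k, 0 ≤ ((star F * N t * F) k k).re := fun t k => by
    have := ((hN t).conjTranspose_mul_mul_same F).diag_nonneg (i := k)
    exact (Complex.nonneg_iff.1 this).1
  have hterm : ∀ t, ∑ j, (if p t * (hN t).1.eigenvalues j -
      (2 : ℝ) ^ (-l) * (hN t).1.eigenvalues j ^ 2 ≤ 0 then 0 else (hN t).1.eigenvalues j) ≤
      (if P < p t then (N t).trace.re else 0) + 2 ^ l * P * G.card +
        ∑ k ∈ Gᶜ, ((star F * N t * F) k k).re := by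
    intro t
    have hsum0 := Finset.sum_nonneg fun k (_ : k ∈ Gᶜ) => hdiag0 t k
    have hμ0 : ∀ j, 0 ≤ (hN t).1.eigenvalues j := fun j => (hN t).eigenvalues_nonneg j
    split_ifs with hPt
    · have htr : (N t).trace.re = ∑ j, (hN t).1.eigenvalues j := by
        rw [(hN t).1.trace_eq_sum_eigenvalues, Complex.re_sum]
        rfl
      have : 0 ≤ 2 ^ l * P * G.card := by positivity
      refine le_trans (Finset.sum_le_sum (g := fun j => (hN t).1.eigenvalues j) fun j _ => ?_)
        (by linarith)
      split_ifs
      · exact hμ0 j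
      · exact le_rfl
    · rw [zero_add]
      have := sum_small_eigenvalues_le (hN t) hF (mul_nonneg h2.le hP)
        (Finset.univ.filter fun j => ¬ (p t * (hN t).1.eigenvalues j -
          (2 : ℝ) ^ (-l) * (hN t).1.eigenvalues j ^ 2 ≤ 0)) G ?_
      · rw [Finset.sum_filter] at this
        refine le_trans (le_of_eq (Finset.sum_congr rfl fun j _ => ?_)) this
        rw [ite_not]
      · intro j hj
        have hj' := not_le.1 (Finset.mem_filter.1 hj).2
        -- Dividing the badness condition by `μ ≥ 0` leaves `2^{-l} μ < p t ≤ P`.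
        have hfac : (hN t).1.eigenvalues j *
            (p t - (2 : ℝ) ^ (-l) * (hN t).1.eigenvalues j) > 0 := by linarith
        have hlt := pos_of_mul_pos_right hfac (hμ0 j)
        have h3 : (2 : ℝ) ^ (-l) * (hN t).1.eigenvalues j < P := by linarith [not_lt.1 hPt]
        rw [Real.rpow_neg (by norm_num), inv_mul_lt_iff₀ h2] at h3
        exact h3.le
  refine (Finset.sum_le_sum fun t _ => hterm t).trans (le_of_eq ?_)
  rw [Finset.sum_add_distrib, Finset.sum_add_distrib, Finset.sum_const, nsmul_eq_mul,
    Finset.card_univ]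
  congr 1
  rw [Finset.sum_comm]
  refine Finset.sum_congr rfl fun k _ => ?_
  rw [Finset.mul_sum, Finset.sum_mul, Matrix.sum_apply, Complex.re_sum]

/-! ### Large deviations and the splitting of a spectrum -/

/-- Chernoff's bound: the weighted sum of a function with mean below `c` is exponentially unlikely
to reach `n * c`. -/
theorem exists_tail_bound {ι : Type*} [Fintype ι] {q : ι → ℝ} (hq : ∀ i, 0 ≤ q i)
    (hq1 : ∑ i, q i = 1) (X : ι → ℝ) {c : ℝ} (hc : ∑ i, q i * X i < c) :
    ∃ z : ℝ, 0 < z ∧ z < 1 ∧ ∀ n : ℕ, ∀ S : Finset (Fin n → ι),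
      (∀ s ∈ S, (∀ i, 0 < q (s i)) → n * c ≤ ∑ i, X (s i)) → ∑ s ∈ S, ∏ i, q (s i) ≤ z ^ n := by
  -- This is the moment generating function of `X - c`. Since `g 0 = 1` and `g' 0 < 0`, some `α > 0`
  -- has `g α < 1`, and `z = g α` works by independence.
  set g : ℝ → ℝ := fun α => ∑ i, q i * Real.exp (α * (X i - c)) with hg
  have hg0 : g 0 = 1 := by simp [hg, hq1]
  have hder : HasDerivAt g (∑ i, q i * (X i - c)) 0 := by
    refine HasDerivAt.fun_sum fun i _ => ?_
    have h1 : HasDerivAt (fun α : ℝ => α * (X i - c)) (X i - c) 0 := by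
      simpa using (hasDerivAt_id (0 : ℝ)).mul_const (X i - c)
    simpa using h1.exp.const_mul (q i)
  have hneg : ∑ i, q i * (X i - c) < 0 := by
    simp only [mul_sub, Finset.sum_sub_distrib, ← Finset.sum_mul, hq1]
    linarith
  obtain ⟨α, hα0, hα⟩ : ∃ α : ℝ, 0 < α ∧ g α < 1 := by
    have h1 := (hasDerivAt_iff_tendsto_slope.1 hder).eventually (gt_mem_nhds hneg)
    have h2 : ∀ᶠ α in 𝓝[>] (0 : ℝ), slope g 0 α < 0 :=
      h1.filter_mono (nhdsWithin_mono _ fun x hx => ne_of_gt hx)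
    obtain ⟨α, hα, hpos⟩ := (h2.and self_mem_nhdsWithin).exists
    refine ⟨α, hpos, ?_⟩
    have hpos' : (0 : ℝ) < α := hpos
    rw [slope_def_field, sub_zero, div_neg_iff] at hα
    rcases hα with h | h
    · linarith [h.2]
    · linarith [h.1]
  have hgpos : 0 < g α := by
    obtain ⟨i, hi⟩ : ∃ i, 0 < q i := by
      by_contra! h
      have : ∑ i, q i ≤ 0 := Finset.sum_nonpos fun i _ => h i
      linarith
    exact Finset.sum_pos' (fun j _ => mul_nonneg (hq j) (Real.exp_pos _).le)
      ⟨i, Finset.mem_univ _, mul_pos hi (Real.exp_pos _)⟩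
  refine ⟨g α, hgpos, hα, fun n S hS => ?_⟩
  rw [hg, Fintype.sum_pow]
  have hnn : ∀ s : Fin n → ι, 0 ≤ ∏ i, q (s i) * Real.exp (α * (X (s i) - c)) := fun s =>
    Finset.prod_nonneg fun i _ => mul_nonneg (hq _) (Real.exp_pos _).le
  refine le_trans (Finset.sum_le_sum fun s hs => ?_) (Finset.sum_le_univ_sum_of_nonneg hnn)
  -- Sequences with a letter of weight zero have product zero. They need no lower bound on `X`,
  -- which matters when `X` is a logarithm with the default value `logb 2 0 = 0`.
  by_cases hpos : ∀ i, 0 < q (s i)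
  · rw [Finset.prod_mul_distrib, ← Real.exp_sum, ← Finset.mul_sum, Finset.sum_sub_distrib,
      Finset.sum_const, Finset.card_univ, Fintype.card_fin, nsmul_eq_mul]
    refine le_mul_of_one_le_right (Finset.prod_nonneg fun i _ => hq _) (Real.one_le_exp ?_)
    exact mul_nonneg hα0.le (by linarith [hS s hs hpos])
  · push Not at hpos
    obtain ⟨i, hi⟩ := hpos
    rw [Finset.prod_eq_zero (Finset.mem_univ i) (le_antisymm hi (hq _))]
    exact hnn s

/-- Eigenvectors with the same label `t` share the eigenvalue `p t`, so their part of the matrix is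
`p t` times a projection. -/
theorem exists_spectral_split {I J T : Type*} [Fintype I] [Fintype J] [Fintype T] [DecidableEq I]
    [DecidableEq J] [DecidableEq T] (e : I ≃ J) {U : Matrix J J ℂ} (hU : U ∈ unitaryGroup J ℂ)
    {d : J → ℝ} (hd : ∀ s, 0 ≤ d s) (τ : J → T) (p : T → ℝ) (hp : ∀ s, d s = p (τ s)) :
    ∃ σ : T → Matrix I I ℂ, (∀ t, (σ t).PosSemidef) ∧
      ∑ t, σ t = (U * diagonal (fun s => (d s : ℂ)) * star U).submatrix e e ∧
      (∀ t, σ t * σ t = (p t : ℂ) • σ t) ∧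
      ∀ t, (σ t).trace.re = ∑ s, if τ s = t then d s else 0 := by
  set D : T → J → ℂ := fun t s => if τ s = t then (d s : ℂ) else 0 with hD
  refine ⟨fun t => (U * diagonal (D t) * star U).submatrix e e, fun t => ?_, ?_, fun t => ?_,
    fun t => ?_⟩
  · refine (PosSemidef.mul_mul_conjTranspose_same (PosSemidef.diagonal fun s => ?_) U).submatrix e
    simp only [hD, Pi.zero_apply]
    split_ifs
    · exact_mod_cast hd s
    · exact le_rfl
  · have h : ∑ t, diagonal (D t) = diagonal (fun s => (d s : ℂ)) := by
      ext s s'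
      rw [Matrix.sum_apply]
      by_cases hs : s = s'
      · subst hs
        simp [hD]
      · simp [hs]
    rw [← h, Matrix.mul_sum, Matrix.sum_mul]
    ext i j
    simp [Matrix.sum_apply]
  · have h : diagonal (D t) * diagonal (D t) = (p t : ℂ) • diagonal (D t) := by
      rw [diagonal_mul_diagonal, ← diagonal_smul]
      congr 1
      ext s
      by_cases hs : τ s = t
      · simp [hD, hs, hp]
      · simp [hD, hs]
    have hUU : star U * U = 1 := mem_unitaryGroup_iff'.1 hU
    rw [submatrix_mul_equiv]
    have : U * diagonal (D t) * star U * (U * diagonal (D t) * star U) =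
        (p t : ℂ) • (U * diagonal (D t) * star U) := by
      calc _ = U * diagonal (D t) * (star U * U) * diagonal (D t) * star U := by
            simp only [Matrix.mul_assoc]
        _ = U * (diagonal (D t) * diagonal (D t)) * star U := by
            rw [hUU, Matrix.mul_one, Matrix.mul_assoc U]
        _ = _ := by rw [h, Matrix.mul_smul, Matrix.smul_mul]
    rw [this]
    rfl
  · have h : ((U * diagonal (D t) * star U).submatrix e e).trace = ∑ s, D t s := by
      rw [← trace_diagonal (D t)]
      calc _ = (U * diagonal (D t) * star U).trace :=
            Equiv.sum_comp e (fun j => (U * diagonal (D t) * star U) j j)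
        _ = _ := by
            rw [Matrix.trace_mul_cycle, mem_unitaryGroup_iff'.1 hU, Matrix.one_mul]
    rw [h, Complex.re_sum]
    refine Finset.sum_congr rfl fun s _ => ?_
    simp only [hD]
    split_ifs <;> simp

/-! ### Tensor powers and types -/

/-- The `n`-th Kronecker power of a matrix. -/
def kroneckerPow {m : Type*} (A : Matrix m m ℂ) (n : ℕ) : Matrix (Fin n → m) (Fin n → m) ℂ :=
  Matrix.of fun x y => ∏ i, A (x i) (y i)

section KroneckerPow

variable {m : Type*} [Fintype m] [DecidableEq m]

theorem kroneckerPow_mul (A A' : Matrix m m ℂ) (n : ℕ) :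
    kroneckerPow (A * A') n = kroneckerPow A n * kroneckerPow A' n := by
  ext x y
  simp only [kroneckerPow, Matrix.of_apply, Matrix.mul_apply, ← Finset.prod_mul_distrib]
  rw [Finset.prod_univ_sum, Fintype.piFinset_univ]

theorem kroneckerPow_star (A : Matrix m m ℂ) (n : ℕ) :
    kroneckerPow (star A) n = star (kroneckerPow A n) := by
  ext x y
  simp [kroneckerPow, Matrix.star_apply]

theorem kroneckerPow_diagonal (d : m → ℂ) (n : ℕ) :
    kroneckerPow (diagonal d) n = diagonal fun x : Fin n → m => ∏ i, d (x i) := by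
  ext x y
  by_cases h : x = y
  · subst h
    simp [kroneckerPow]
  · obtain ⟨i, hi⟩ := Function.ne_iff.1 h
    rw [Matrix.diagonal_apply_ne _ h]
    exact Finset.prod_eq_zero (Finset.mem_univ i) (Matrix.diagonal_apply_ne _ hi)

theorem kroneckerPow_one (n : ℕ) : kroneckerPow (1 : Matrix m m ℂ) n = 1 := by
  rw [← diagonal_one, kroneckerPow_diagonal]
  simp

theorem kroneckerPow_mem_unitaryGroup {U : Matrix m m ℂ} (hU : U ∈ unitaryGroup m ℂ) (n : ℕ) :
    kroneckerPow U n ∈ unitaryGroup (Fin n → m) ℂ := by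
  rw [mem_unitaryGroup_iff, ← kroneckerPow_star, ← kroneckerPow_mul, mem_unitaryGroup_iff.1 hU,
    kroneckerPow_one]

theorem eq_unitary_mul_diagonal {A : Matrix m m ℂ} (hA : A.IsHermitian) :
    A = (hA.eigenvectorUnitary : Matrix m m ℂ) * diagonal (fun i => (hA.eigenvalues i : ℂ)) *
      star (hA.eigenvectorUnitary : Matrix m m ℂ) := by
  conv_lhs => rw [hA.spectral_theorem, Unitary.conjStarAlgAut_apply]
  rfl

theorem kroneckerPow_eq {A : Matrix m m ℂ} (hA : A.IsHermitian) (n : ℕ) :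
    kroneckerPow A n = kroneckerPow (hA.eigenvectorUnitary : Matrix m m ℂ) n *
      diagonal (fun s => ((∏ i, hA.eigenvalues (s i) : ℝ) : ℂ)) *
      star (kroneckerPow (hA.eigenvectorUnitary : Matrix m m ℂ) n) := by
  conv_lhs => rw [eq_unitary_mul_diagonal hA]
  rw [kroneckerPow_mul, kroneckerPow_mul, kroneckerPow_star, kroneckerPow_diagonal]
  push_cast
  rfl

end KroneckerPow

variable {a b : Type*} [Fintype a] [Fintype b] [DecidableEq a] [DecidableEq b]

theorem marginalB_tensorPower (ρ : Matrix (a × b) (a × b) ℂ) (n : ℕ) :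
    marginalB (tensorPower ρ n) = kroneckerPow (marginalB ρ) n := by
  ext y y'
  simp only [marginalB, tensorPower, kroneckerPow, Matrix.of_apply]
  rw [Finset.prod_univ_sum, Fintype.piFinset_univ]

theorem tensorPower_eq_submatrix (ρ : Matrix (a × b) (a × b) ℂ) (n : ℕ) :
    tensorPower ρ n = (kroneckerPow ρ n).submatrix
      (Equiv.arrowProdEquivProdArrow (Fin n) (fun _ => a) (fun _ => b)).symm
      (Equiv.arrowProdEquivProdArrow (Fin n) (fun _ => a) (fun _ => b)).symm := rfl

theorem trace_kroneckerPow {m : Type*} [Fintype m] (A : Matrix m m ℂ) (n : ℕ) :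
    (kroneckerPow A n).trace = A.trace ^ n := by
  rw [Matrix.trace, Matrix.trace, Fintype.sum_pow]
  rfl

theorem trace_tensorPower (ρ : Matrix (a × b) (a × b) ℂ) (n : ℕ) :
    (tensorPower ρ n).trace = ρ.trace ^ n := by
  rw [← trace_marginalB, marginalB_tensorPower, trace_kroneckerPow, trace_marginalB]

/-- A product over a sequence depends on its type only, and there are at most `(n + 1) ^ |ι|`
types. -/
theorem exists_type_class {ι : Type*} [Fintype ι] [DecidableEq ι] (q : ι → ℝ) (n : ℕ) :
    ∃ (τ : (Fin n → ι) → Fin (Fintype.card ι) → Fin (n + 1))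
      (p : (Fin (Fintype.card ι) → Fin (n + 1)) → ℝ), ∀ s, ∏ i, q (s i) = p (τ s) := by
  have hlt : ∀ (s : Fin n → ι) (j : ι), (Finset.univ.filter fun i => s i = j).card < n + 1 :=
    fun s j => Nat.lt_succ_of_le ((Finset.card_le_univ _).trans_eq (Fintype.card_fin n))
  -- Letters are numbered by `Fin (Fintype.card ι)` so that the set of types lies in `Type`, as the
  -- register must, whatever the universe of `ι`.
  refine ⟨fun s k => ⟨_, hlt s ((Fintype.equivFin ι).symm k)⟩,
    fun t => ∏ k, q ((Fintype.equivFin ι).symm k) ^ (t k : ℕ), fun s => ?_⟩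
  dsimp only
  rw [Equiv.prod_comp (Fintype.equivFin ι).symm
    (fun j => q j ^ (Finset.univ.filter fun i => s i = j).card)]
  rw [← Finset.prod_fiberwise Finset.univ s]
  refine Finset.prod_congr rfl fun j _ => ?_
  rw [Finset.prod_congr rfl fun i hi => by rw [(Finset.mem_filter.1 hi).2], Finset.prod_const]

/-- The one-shot bound for the splitting by types, with `F` the product eigenbasis of `ρ_B^{⊗n}`;
all errors become sums over sequences of eigenvalues. -/
theorem le_optCollisionEntropy_tensorPower {ρ : Matrix (a × b) (a × b) ℂ} (hρ : ρ.PosSemidef)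
    (htr : ρ.trace = 1) (n : ℕ) {l P ε : ℝ} (hP : 0 ≤ P) (G : Finset (Fin n → b))
    (h : (∑ s : Fin n → a × b with P < ∏ i, hρ.1.eigenvalues (s i),
        ∏ i, hρ.1.eigenvalues (s i)) +
      ((n : ℝ) + 1) ^ Fintype.card (a × b) * (2 ^ l * P * G.card) +
      ∑ k ∈ Gᶜ, ∏ i, (posSemidef_marginalB hρ).1.eigenvalues (k i) ≤ ε) :
    (l : EReal) ≤ optCollisionEntropy (tensorPower ρ n) ε := by
  obtain ⟨τ, p, hp⟩ := exists_type_class hρ.1.eigenvalues n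
  obtain ⟨σ, hσ, hsum, hσσ, hσtr⟩ := exists_spectral_split
    (Equiv.arrowProdEquivProdArrow (Fin n) (fun _ => a) (fun _ => b)).symm
    (kroneckerPow_mem_unitaryGroup hρ.1.eigenvectorUnitary.2 n)
    (fun s => Finset.prod_nonneg fun i _ => hρ.eigenvalues_nonneg (s i)) τ p hp
  rw [← kroneckerPow_eq, ← tensorPower_eq_submatrix] at hsum
  have hB := posSemidef_marginalB hρ
  have hF := kroneckerPow_mem_unitaryGroup hB.1.eigenvectorUnitary.2 n
  refine le_optCollisionEntropy (by rw [trace_tensorPower, htr, one_pow]) hσ hsum hσσ ?_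
  refine (sum_bad_eigenvalues_le (fun t => posSemidef_marginalB (hσ t)) hF p l P hP G).trans
    (le_trans (le_of_eq ?_) h)
  congr 1
  · congr 1
    · simp only [trace_marginalB, hσtr]
      rw [Finset.sum_filter]
      calc _ = ∑ t, ∑ s, (if τ s = t then (if P < p t then ∏ i, hρ.1.eigenvalues (s i) else 0)
            else 0) := by
            refine Finset.sum_congr rfl fun t _ => ?_
            split_ifs
            · rfl
            · simp
        _ = _ := by
            rw [Finset.sum_comm]
            refine Finset.sum_congr rfl fun s _ => ?_
            rw [Finset.sum_ite_eq, if_pos (Finset.mem_univ _), ← hp]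
    · simp
  · refine Finset.sum_congr rfl fun k _ => ?_
    rw [← marginalB_sum, hsum, marginalB_tensorPower, kroneckerPow_eq hB.1]
    have hUU := mem_unitaryGroup_iff'.1 hF
    rw [← Matrix.mul_assoc, ← Matrix.mul_assoc, hUU, Matrix.one_mul, Matrix.mul_assoc, hUU,
      Matrix.mul_one, diagonal_apply_eq, Complex.ofReal_re]

/-! ### Entropies and the exponential error bound -/

theorem vonNeumann_eq {m : Type*} [Fintype m] [DecidableEq m] {A : Matrix m m ℂ}
    (hA : A.IsHermitian) :
    vonNeumann A = -∑ i, hA.eigenvalues i * Real.logb 2 (hA.eigenvalues i) := by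
  rw [vonNeumann, hA.cfc_eq, IsHermitian.cfc, Unitary.conjStarAlgAut_apply,
    Matrix.trace_mul_cycle, mem_unitaryGroup_iff'.1 hA.eigenvectorUnitary.2, Matrix.one_mul,
    trace_diagonal, Complex.re_sum]
  rfl

theorem sum_eigenvalues_eq_one {m : Type*} [Fintype m] [DecidableEq m] {A : Matrix m m ℂ}
    (hA : A.IsHermitian) (htr : A.trace = 1) : ∑ i, hA.eigenvalues i = 1 := by
  have h : ((∑ i, hA.eigenvalues i : ℝ) : ℂ) = 1 := by
    rw [← htr, hA.trace_eq_sum_eigenvalues]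
    simp
  exact_mod_cast h

theorem logb_prod_of_pos {n : ℕ} {x : Fin n → ℝ} (hx : ∀ i, 0 < x i) :
    Real.logb 2 (∏ i, x i) = ∑ i, Real.logb 2 (x i) :=
  Real.logb_prod _ _ fun i _ => (hx i).ne'

/-- Below the conditional entropy, the achievability error is exponentially small. -/
theorem exists_rate_bound {ρ : Matrix (a × b) (a × b) ℂ} (hρ : ρ.PosSemidef) (htr : ρ.trace = 1)
    {δ : ℝ} (hδ : 0 < δ) :
    ∃ w : ℝ, 0 < w ∧ w < 1 ∧ ∀ (n : ℕ) (ε : ℝ),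
      (((n : ℝ) + 1) ^ Fintype.card (a × b) + 2) * w ^ n ≤ ε →
      ((n * (condEntropy ρ - 3 * δ) : ℝ) : EReal) ≤ optCollisionEntropy (tensorPower ρ n) ε := by
  have hB := posSemidef_marginalB hρ
  have hBtr : (marginalB ρ).trace = 1 := by rw [trace_marginalB, htr]
  set q := hρ.1.eigenvalues with hq
  set r := hB.1.eigenvalues with hr
  have hq0 : ∀ i, 0 ≤ q i := fun i => hρ.eigenvalues_nonneg i
  have hr0 : ∀ i, 0 ≤ r i := fun i => hB.eigenvalues_nonneg i
  have hq1 : ∑ i, q i = 1 := sum_eigenvalues_eq_one hρ.1 htr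
  have hr1 : ∑ i, r i = 1 := sum_eigenvalues_eq_one hB.1 hBtr
  set HA := vonNeumann ρ with hHA
  set HB := vonNeumann (marginalB ρ) with hHB
  have hHA' : HA = -∑ i, q i * Real.logb 2 (q i) := vonNeumann_eq hρ.1
  have hHB' : HB = -∑ i, r i * Real.logb 2 (r i) := vonNeumann_eq hB.1
  -- The mean of `logb 2 q` under `q` is `-HA`, and that of `-logb 2 r` under `r` is `HB`; each
  -- threshold exceeds its mean by `δ`.
  obtain ⟨z₁, hz₁, hz₁', h₁⟩ := exists_tail_bound hq0 hq1 (fun i => Real.logb 2 (q i))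
    (c := -(HA - δ)) (by linarith)
  obtain ⟨z₂, hz₂, hz₂', h₂⟩ := exists_tail_bound hr0 hr1 (fun i => -Real.logb 2 (r i))
    (c := HB + δ) (by
      simp only [mul_neg, Finset.sum_neg_distrib]
      linarith)
  set z₃ : ℝ := 2 ^ (-δ) with hz₃
  have hz₃0 : 0 < z₃ := by positivity
  have hz₃1 : z₃ < 1 := Real.rpow_lt_one_of_one_lt_of_neg (by norm_num) (by linarith)
  refine ⟨max (max z₁ z₂) z₃, lt_max_of_lt_right hz₃0, max_lt (max_lt hz₁' hz₂') hz₃1,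
    fun n ε hε => ?_⟩
  set w := max (max z₁ z₂) z₃ with hw
  set θ : ℝ := 2 ^ (-(n * (HB + δ))) with hθ
  have hθ0 : 0 < θ := by positivity
  refine le_optCollisionEntropy_tensorPower hρ htr n
    (P := 2 ^ (-(n * (HA - δ)))) (by positivity)
    (Finset.univ.filter fun k : Fin n → b => θ ≤ ∏ i, r (k i)) (le_trans ?_ hε)
  have e₁ : (∑ s : Fin n → a × b with (2 : ℝ) ^ (-(n * (HA - δ))) < ∏ i, q (s i),
      ∏ i, q (s i)) ≤ w ^ n := by
    refine (h₁ n _ fun s hs hpos => ?_).trans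
      (pow_le_pow_left₀ hz₁.le ((le_max_left _ _).trans (le_max_left _ _)) n)
    have hs' := (Finset.mem_filter.1 hs).2
    rw [← logb_prod_of_pos hpos, Real.le_logb_iff_rpow_le (by norm_num)
      (Finset.prod_pos fun i _ => hpos i)]
    refine le_trans (le_of_eq ?_) hs'.le
    congr 1
    ring
  have e₂ : ∑ k ∈ (Finset.univ.filter fun k : Fin n → b => θ ≤ ∏ i, r (k i))ᶜ,
      ∏ i, r (k i) ≤ w ^ n := by
    refine (h₂ n _ fun s hs hpos => ?_).trans
      (pow_le_pow_left₀ hz₂.le ((le_max_right _ _).trans (le_max_left _ _)) n)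
    have hs' : ∏ i, r (s i) < θ := by simpa using hs
    have := (Real.logb_le_iff_le_rpow (b := 2) (by norm_num)
      (Finset.prod_pos fun i _ => hpos i)).2 hs'.le
    rw [logb_prod_of_pos hpos] at this
    rw [Finset.sum_neg_distrib]
    linarith
  have hcard : θ * (Finset.univ.filter fun k : Fin n → b => θ ≤ ∏ i, r (k i)).card ≤ 1 := by
    calc _ = ∑ k ∈ Finset.univ.filter (fun k : Fin n → b => θ ≤ ∏ i, r (k i)), θ := by
          rw [Finset.sum_const, nsmul_eq_mul, mul_comm]
      _ ≤ ∑ k ∈ Finset.univ.filter (fun k : Fin n → b => θ ≤ ∏ i, r (k i)), ∏ i, r (k i) :=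
          Finset.sum_le_sum fun k hk => (Finset.mem_filter.1 hk).2
      _ ≤ ∑ k : Fin n → b, ∏ i, r (k i) :=
          Finset.sum_le_univ_sum_of_nonneg fun k => Finset.prod_nonneg fun i _ => hr0 _
      _ = 1 := by rw [← Fintype.sum_pow, hr1, one_pow]
  have e₃ : (2 : ℝ) ^ ((n : ℝ) * (condEntropy ρ - 3 * δ)) * 2 ^ (-(n * (HA - δ))) *
      (Finset.univ.filter fun k : Fin n → b => θ ≤ ∏ i, r (k i)).card ≤ w ^ n := by
    -- Two of the three `δ` in the rate pay for the margins in `P` and `θ`; the third leaves the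
    -- decay `z₃ ^ n`.
    have hexp : (2 : ℝ) ^ ((n : ℝ) * (condEntropy ρ - 3 * δ)) * 2 ^ (-(n * (HA - δ))) =
        z₃ ^ n * θ := by
      rw [hz₃, hθ, ← Real.rpow_natCast, ← Real.rpow_mul (by norm_num),
        ← Real.rpow_add (by norm_num), ← Real.rpow_add (by norm_num), condEntropy]
      congr 1
      ring
    rw [hexp, mul_assoc]
    exact (mul_le_of_le_one_right (by positivity) hcard).trans
      (pow_le_pow_left₀ hz₃0.le (le_max_right _ _) n)
  have e₃' := mul_le_mul_of_nonneg_left e₃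
    (by positivity : (0 : ℝ) ≤ ((n : ℝ) + 1) ^ Fintype.card (a × b))
  linarith

/-! ### Subexponential sequences and the limit -/

theorem tendsto_add_one_pow_mul_pow (d : ℕ) {x : ℝ} (hx0 : 0 < x) (hx1 : x < 1) :
    Tendsto (fun n : ℕ => ((n : ℝ) + 1) ^ d * x ^ n) atTop (𝓝 0) := by
  have h := ((tendsto_pow_const_mul_const_pow_of_lt_one d hx0.le hx1).comp
    (tendsto_add_atTop_nat 1)).mul_const x⁻¹
  rw [zero_mul] at h
  refine h.congr fun n => ?_
  simp only [Function.comp_apply]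
  push_cast
  rw [pow_succ]
  field_simp

/-- A sequence that decays slower than exponentially dominates any polynomially corrected
exponential. -/
theorem eventually_poly_mul_pow_le (d : ℕ) {w : ℝ} (hw0 : 0 < w) (hw1 : w < 1) {ε : ℕ → ℝ}
    (hε : ∀ᶠ n in atTop, 0 < ε n)
    (hlog : Tendsto (fun n : ℕ => Real.logb 2 (ε n) / (n : ℝ)) atTop (𝓝 0)) :
    ∀ᶠ n : ℕ in atTop, (((n : ℝ) + 1) ^ d + 2) * w ^ n ≤ ε n := by
  -- The intermediate rate `y` separates the tasks: eventually `y ^ n ≤ ε n`, while `(w / y) ^ n`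
  -- absorbs the polynomial.
  obtain ⟨y, hwy, hy1⟩ := exists_between hw1
  have hy0 : 0 < y := hw0.trans hwy
  have hx0 : 0 < w / y := div_pos hw0 hy0
  have hx1 : w / y < 1 := (div_lt_one hy0).2 hwy
  have hlim := (tendsto_add_one_pow_mul_pow d hx0 hx1).add
    ((tendsto_pow_atTop_nhds_zero_of_lt_one hx0.le hx1).const_mul 2)
  rw [mul_zero, add_zero] at hlim
  have hlogy : Real.logb 2 y < 0 := Real.logb_neg (by norm_num) hy0 hy1
  filter_upwards [hlim.eventually (gt_mem_nhds one_pos), hlog.eventually (lt_mem_nhds hlogy), hε,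
    eventually_gt_atTop 0] with n h1 h2 h3 h4
  have hn : (0 : ℝ) < n := by exact_mod_cast h4
  have hyε : y ^ n ≤ ε n := by
    rw [lt_div_iff₀ hn] at h2
    have h5 : Real.logb 2 (y ^ n) ≤ Real.logb 2 (ε n) := by
      rw [Real.logb_pow]
      linarith
    exact (Real.logb_le_logb (by norm_num) (by positivity) h3).1 h5
  refine le_trans ?_ hyε
  have h6 : (((n : ℝ) + 1) ^ d + 2) * w ^ n =
      (((n : ℝ) + 1) ^ d * (w / y) ^ n + 2 * (w / y) ^ n) * y ^ n := by
    rw [div_pow]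
    field_simp
  rw [h6]
  exact mul_le_of_le_one_left (by positivity) h1.le

theorem condEntropy_le_liminf {ρ : Matrix (a × b) (a × b) ℂ} (hρ : ρ.PosSemidef)
    (htr : ρ.trace = 1) {ε : ℕ → ℝ} (hε : ∀ᶠ n in atTop, 0 < ε n)
    (hlog : Tendsto (fun n : ℕ => Real.logb 2 (ε n) / (n : ℝ)) atTop (𝓝 0)) :
    ((condEntropy ρ : ℝ) : EReal) ≤ liminf (fun n : ℕ =>
      optCollisionEntropy (tensorPower ρ n) (ε n) / (n : EReal)) atTop := by
  rw [← EReal.ge_of_forall_gt_iff_ge]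
  intro z hz
  have hz' : z < condEntropy ρ := by exact_mod_cast hz
  -- This `δ` makes the rate `condEntropy ρ - 3 * δ` equal to `z`.
  obtain ⟨w, hw0, hw1, h⟩ := exists_rate_bound hρ htr (δ := (condEntropy ρ - z) / 3)
    (by linarith)
  refine le_liminf_of_le (by isBoundedDefault) ?_
  filter_upwards [eventually_poly_mul_pow_le _ hw0 hw1 hε hlog, eventually_gt_atTop 0] with n hn hn0
  have hn1 : (0 : EReal) < n := by exact_mod_cast hn0
  rw [EReal.le_div_iff_mul_le hn1 (EReal.natCast_ne_top n)]
  refine le_trans (le_of_eq ?_) (h n _ hn)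
  rw [← EReal.coe_natCast, ← EReal.coe_mul]
  congr 1
  ring

/-! ### The explicit smoothing sequence -/

theorem tendsto_poly_mul_two_rpow (k : ℕ) {ν : ℝ} (hν : 0 < ν) :
    Tendsto (fun n : ℕ => (1 + n : ℝ) ^ k * (2 : ℝ) ^ (-(n : ℝ) ^ ν)) atTop (𝓝 0) := by
  -- With `x = n ^ ν`, the power `n ^ k` becomes `x ^ (k / ν)`; the factor `2 ^ k` comes from `1 + n
  -- ≤ 2 n`.
  have h := ((tendsto_rpow_mul_exp_neg_mul_atTop_nhds_zero (k / ν) (Real.log 2)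
    (Real.log_pos (by norm_num))).comp
      ((tendsto_rpow_atTop hν).comp tendsto_natCast_atTop_atTop)).const_mul ((2 : ℝ) ^ k)
  rw [mul_zero] at h
  refine squeeze_zero' (Eventually.of_forall fun n => by positivity) ?_ h
  filter_upwards [eventually_ge_atTop 1] with n hn
  have hn' : (1 : ℝ) ≤ n := by exact_mod_cast hn
  simp only [Function.comp_apply]
  rw [← Real.rpow_mul (by positivity), mul_div_cancel₀ _ hν.ne', Real.rpow_natCast, ← mul_assoc,
    ← mul_pow, Real.rpow_def_of_pos (by norm_num : (0 : ℝ) < 2)]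
  have : Real.log 2 * -(n : ℝ) ^ ν = -Real.log 2 * (n : ℝ) ^ ν := by ring
  rw [this]
  refine mul_le_mul_of_nonneg_right (pow_le_pow_left₀ (by positivity) ?_ k) (Real.exp_pos _).le
  linarith

theorem tendsto_smoothing (dA dB : ℕ) {ν : ℝ} (hν : 0 < ν) :
    Tendsto (smoothing dA dB ν) atTop (𝓝 0) := by
  have h1 := tendsto_poly_mul_two_rpow (dA * dB) hν
  have h2 := tendsto_poly_mul_two_rpow dB hν
  have h3 := (Real.continuous_sqrt.tendsto 0).comp h1
  rw [Real.sqrt_zero] at h3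
  have h := (h3.add h1).add h2
  rw [add_zero, add_zero] at h
  exact h

theorem two_rpow_le_smoothing (dA dB : ℕ) (ν : ℝ) (n : ℕ) :
    (2 : ℝ) ^ (-(n : ℝ) ^ ν) ≤ smoothing dA dB ν n := by
  have h1 : (1 : ℝ) ≤ (1 + n : ℝ) ^ dB := one_le_pow₀ (by linarith [Nat.cast_nonneg (α := ℝ) n])
  have h2 := le_mul_of_one_le_left (by positivity : (0 : ℝ) ≤ (2 : ℝ) ^ (-(n : ℝ) ^ ν)) h1
  have h3 : 0 ≤ Real.sqrt ((1 + n : ℝ) ^ (dA * dB) * (2 : ℝ) ^ (-(n : ℝ) ^ ν)) :=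
    Real.sqrt_nonneg _
  have h4 : 0 ≤ (1 + n : ℝ) ^ (dA * dB) * (2 : ℝ) ^ (-(n : ℝ) ^ ν) := by positivity
  rw [smoothing]
  linarith

theorem tendsto_logb_smoothing_div (dA dB : ℕ) {ν : ℝ} (hν : 0 < ν) (hν1 : ν < 1) :
    Tendsto (fun n : ℕ => Real.logb 2 (smoothing dA dB ν n) / (n : ℝ)) atTop (𝓝 0) := by
  -- The quotient is squeezed between `-n ^ (ν - 1)`, which tends to zero because `ν < 1`, and `0`,
  -- valid once the smoothing drops below `1`.
  have h := ((tendsto_rpow_neg_atTop (sub_pos.2 hν1)).comp tendsto_natCast_atTop_atTop).neg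
  rw [neg_zero] at h
  refine tendsto_of_tendsto_of_tendsto_of_le_of_le' h tendsto_const_nhds ?_ ?_
  · filter_upwards [eventually_gt_atTop 0] with n hn
    have hn' : (0 : ℝ) < n := by exact_mod_cast hn
    have h1 : -(n : ℝ) ^ ν ≤ Real.logb 2 (smoothing dA dB ν n) := by
      rw [Real.le_logb_iff_rpow_le (by norm_num)
        (lt_of_lt_of_le (by positivity) (two_rpow_le_smoothing dA dB ν n))]
      exact two_rpow_le_smoothing dA dB ν n
    rw [le_div_iff₀ hn']
    refine le_trans (le_of_eq ?_) h1
    simp only [Function.comp_apply]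
    rw [neg_mul, ← Real.rpow_add_one hn'.ne']
    congr 2
    ring
  · filter_upwards [(tendsto_smoothing dA dB hν).eventually (gt_mem_nhds one_pos)] with n hn
    exact div_nonpos_of_nonpos_of_nonneg (Real.logb_nonpos (by norm_num)
      (le_trans (by positivity) (two_rpow_le_smoothing dA dB ν n)) hn.le) (Nat.cast_nonneg n)

end QEntropy

theorem corollary1 {a b : Type*} [Fintype a] [DecidableEq a] [Fintype b] [DecidableEq b]
    (ρ : Matrix (a × b) (a × b) ℂ) (hρ : ρ.PosSemidef) (htr : ρ.trace = 1) :
    (∀ ε : ℕ → ℝ, (∀ n, 0 < ε n) → Tendsto ε atTop (𝓝 0) →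
      Tendsto (fun n : ℕ => Real.logb 2 (ε n) / (n : ℝ)) atTop (𝓝 0) →
      ((QEntropy.condEntropy ρ : ℝ) : EReal) ≤
        liminf (fun n : ℕ =>
          QEntropy.optCollisionEntropy (QEntropy.tensorPower ρ n) (ε n) / (n : EReal)) atTop) ∧
    (∀ ν : ℝ, 0 < ν → ν < 1 →
      Tendsto (QEntropy.smoothing (Fintype.card a) (Fintype.card b) ν) atTop (𝓝 0) ∧
      ((QEntropy.condEntropy ρ : ℝ) : EReal) ≤
        liminf (fun n : ℕ =>
          QEntropy.optCollisionEntropy (QEntropy.tensorPower ρ n)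
            (QEntropy.smoothing (Fintype.card a) (Fintype.card b) ν n) / (n : EReal)) atTop) := by
  exact ⟨fun ε hε _ hlog =>
      QEntropy.condEntropy_le_liminf hρ htr (Eventually.of_forall hε) hlog,
    fun ν hν hν1 => ⟨QEntropy.tendsto_smoothing _ _ hν,
      QEntropy.condEntropy_le_liminf hρ htr (Eventually.of_forall fun n =>
          lt_of_lt_of_le (by positivity) (QEntropy.two_rpow_le_smoothing _ _ ν n))
        (QEntropy.tendsto_logb_smoothing_div _ _ hν hν1)⟩⟩
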